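/- Let $\mathcal G$ be a finite directed graph (parallel edges allowed, no self-loops) with $n$ vertices, $m$ edges and incidence matrix $B\in\mathbb R^{n\times m}$ ($B_{ij}=1$ if edge $j$ points to vertex $i$, $-1$ if it leaves vertex $i$, $0$ otherwise). Assume that $\mathcal G$ is strongly connected. Let $u^-,u^+\in\mathbb R^m$ with $u^-_i<u^+_i$ for all $i$, and assume that the graph is compatible with these constraints, i.e. $u_i^+>0$ and $u_i^-\ge 0$ for all $i$. For $z\in\mathbb R^m$ let $\mathrm{sat}(z;u^-,u^+)\in\mathbb R^m$ be the vector with $i$-th component $u_i^-$ if $z_i\le u_i^-$, $z_i$ if $u_i^-<z_i<u_i^+$, and $u_i^+$ if $z_i\ge u_i^+$. Let $H:\mathbb R^n\to\mathbb R$ be twice continuously differentiable with positive definite Hessian matrix at every point, and assume that $H$ is radially unbounded on every hyperplane $\{x\mid \mathbb 1^Tx=c\}$, $c\in\mathbb R$ (for instance, that $H$ is radially unbounded on $\mathbb R^n$). Consider the closed-loop system $$\dot x = B\,\mathrm{sat}\Big(-B^T\frac{\partial H}{\partial x}(x)-x_c;\,u^-,u^+\Big),\qquad \dot x_c=B^T\frac{\partial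 H}{\partial x}(x).$$ Let $\mathcal T$ be a minimal covering set of $\mathcal G$: a set of directed cycles (without repeated vertices) such that every edge belongs to at least one of them, and no proper subset of which has this property. Let $T_i\ge 1$ be the number of cycles in $\mathcal T$ that contain edge $i$, and let $\tilde{\mathcal G}(\mathcal T)$ be the augmented graph obtained from $\mathcal G$ by replacing each edge $i$ by $T_i$ parallel copies $i_1,\dots,i_{T_i}$ with the same tail and head. A splitting consists of numbers $u_i^-=b_{i,1}<b_{i,2}<\cdots<b_{i,T_i}<b_{i,T_i+1}=u_i^+$ for every edge $i$; it gives the copy $i_1$ the constraint interval $[u_i^-,b_{i,2}]$ and the copy $i_k$, $k=2,\dots,T_i$, the constraint interval $[0,b_{i,k+1}-b_{i,k}]$. Let $\tilde{\mathcal T}=\{\tilde C_1,\dots,\tilde C_k\}$ be a set of directed cycles of $\tilde{\mathcal G}(\mathcal T)$ such that every edge of $\tilde{\mathcal G}(\mathcal T)$ belongs to exactly one of them. If there is a splitting such that, for every $j=1,\dots,k$, the intersection of the constraint intervals of all edges of $\tilde C_j$ has non-empty interior, then every trajectory $(x(t),x_c(t))$, $t\ge 0$, of the closed-loop system converges to the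 set $$\mathcal E_{\mathrm{tot}}=\Big\{(x,x_c)\;\Big|\;\frac{\partial H}{\partial x}(x)=\alpha\mathbb 1,\ \alpha\in\mathbb R,\ B\,\mathrm{sat}(-x_c;u^-,u^+)=0\Big\},$$ i.e. the distance from $(x(t),x_c(t))$ to $\mathcal E_{\mathrm{tot}}$ tends to $0$ as $t\to\infty$ (in particular, if there is a trajectory, $\mathcal E_{\mathrm{tot}}$ is non-empty). -/

import Mathlib

open Filter Topology Matrix Set

noncomputable section

/-- A directed graph with vertex set `V` and edge set `E`; parallel edges are allowed,
self-loops are not. -/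
structure DiMultigraph (V E : Type*) where
  tail : E → V
  head : E → V
  no_loop : ∀ e, tail e ≠ head e

namespace DiMultigraph

variable {V E : Type*}

/-- Every vertex can be reached from every vertex along directed edges. -/
def StronglyConnected (G : DiMultigraph V E) : Prop :=
  ∀ v w, Relation.ReflTransGen (fun a b => ∃ e, G.tail e = a ∧ G.head e = b) v w

/-- The incidence matrix: `1` at the head, `-1` at the tail, `0` elsewhere. -/
def incidence [DecidableEq V] (G : DiMultigraph V E) : Matrix V E ℝ :=
  fun v e => if G.head e = v then 1 else if G.tail e = v then -1 else 0

/-- `C` is the edge set of a directed cycle (no vertex repeated): its edges can be listed as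
`e 0, …, e k` so that the tails are distinct and the head of each edge is the tail of the next one,
where the successor of `k` in `Fin (k + 1)` is `0`. -/
def IsCycle [DecidableEq E] (G : DiMultigraph V E) (C : Finset E) : Prop :=
  ∃ (k : ℕ) (e : Fin (k + 1) → E),
    Function.Injective (fun i => G.tail (e i)) ∧
    (∀ i, G.head (e i) = G.tail (e (i + 1))) ∧
    C = Finset.univ.image e

/-- A set of directed cycles that covers all edges. -/
def IsCycleCover [DecidableEq E] (G : DiMultigraph V E) (T : Finset (Finset E)) : Prop :=
  (∀ C ∈ T, G.IsCycle C) ∧ ∀ e, ∃ C ∈ T, e ∈ C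

/-- A cover by directed cycles, no two of which share an edge. -/
def IsNonOverlappingCycleCover [DecidableEq E] (G : DiMultigraph V E)
    (T : Finset (Finset E)) : Prop :=
  G.IsCycleCover T ∧ (T : Set (Finset E)).PairwiseDisjoint id

end DiMultigraph

/-- The number of members of `T` that contain the edge `e`. -/
def edgeMultiplicity {E : Type*} [DecidableEq E] (T : Finset (Finset E)) (e : E) : ℕ :=
  (T.filter (fun C => e ∈ C)).card

/-- The edges of the augmented graph: each edge `e` is replaced by as many copies as its
multiplicity. -/
abbrev SplitEdge {E : Type*} [DecidableEq E] (T : Finset (Finset E)) : Type _ :=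
  Σ e : E, Fin (edgeMultiplicity T e)

/-- The augmented graph: all copies of an edge keep its tail and its head. -/
def DiMultigraph.augmented {V E : Type*} [DecidableEq E] (G : DiMultigraph V E)
    (T : Finset (Finset E)) : DiMultigraph V (SplitEdge T) where
  tail p := G.tail p.1
  head p := G.head p.1
  no_loop p := G.no_loop p.1

/-- Break points `um e = b e 0 < b e 1 < ⋯ < b e (T_e) = up e` for every edge `e`, where `T_e` is
the multiplicity of `e`. -/
structure IsSplitting {E : Type*} [DecidableEq E] (T : Finset (Finset E)) (um up : E → ℝ)
    (b : (e : E) → Fin (edgeMultiplicity T e + 1) → ℝ) : Prop where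
  strictMono : ∀ e, StrictMono (b e)
  first : ∀ e, b e 0 = um e
  last : ∀ e, b e (Fin.last _) = up e

/-- The constraint intervals of the copies of an edge:
the first copy has `[b 0, b 1]`, the copy number `k > 0` has `[0, b (k + 1) - b k]`. -/
def splitInterval {E : Type*} [DecidableEq E] {T : Finset (Finset E)}
    (b : (e : E) → Fin (edgeMultiplicity T e + 1) → ℝ) (p : SplitEdge T) : Set ℝ :=
  if (p.2 : ℕ) = 0 then Icc (b p.1 p.2.castSucc) (b p.1 p.2.succ)
  else Icc 0 (b p.1 p.2.succ - b p.1 p.2.castSucc)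

/-- The scalar saturation function with bounds `a` and `b`. -/
def sat (z a b : ℝ) : ℝ :=
  if z ≤ a then a else if z < b then z else b

/-- The componentwise saturation function. -/
def satVec {E : Type*} (z um up : E → ℝ) : E → ℝ := fun e => sat (z e) (um e) (up e)

/-- The orientation of the edges is compatible with the flow constraints. -/
def Compatible {E : Type*} (um up : E → ℝ) : Prop :=
  (∀ e, 0 < up e) ∧ ∀ e, 0 ≤ um e

/-- The Hessian matrix: the `(i, j)` entry is the `j`-th partial derivative of the `i`-th partial
derivative of `H`. -/
def hessianMatrix {V : Type*} [Fintype V] [DecidableEq V] (H : EuclideanSpace ℝ V → ℝ)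
    (x : EuclideanSpace ℝ V) : Matrix V V ℝ :=
  fun i j => fderiv ℝ (fun y => gradient H y i) x (EuclideanSpace.single j 1)

/-- `(x, xc)` is a trajectory on `[0, ∞)` of the closed-loop system
`x' = B sat(-Bᵀ ∇H(x) - xc; um, up)`, `xc' = Bᵀ ∇H(x)`. -/
structure IsClosedLoopTrajectory {V E : Type*} [Fintype V] [DecidableEq V] [Fintype E]
    (G : DiMultigraph V E) (H : EuclideanSpace ℝ V → ℝ) (um up : E → ℝ)
    (x : ℝ → EuclideanSpace ℝ V) (xc : ℝ → EuclideanSpace ℝ E) : Prop where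
  deriv_x : ∀ t ∈ Ici (0 : ℝ), HasDerivWithinAt x
    (WithLp.toLp 2 (G.incidence *ᵥ
      satVec (-(G.incidenceᵀ *ᵥ (gradient H (x t)).ofLp) - (xc t).ofLp) um up)) (Ici 0) t
  deriv_xc : ∀ t ∈ Ici (0 : ℝ), HasDerivWithinAt xc
    (WithLp.toLp 2 (G.incidenceᵀ *ᵥ (gradient H (x t)).ofLp)) (Ici 0) t

/-- The load balancing set
`{(x, xc) | ∇H(x) = α 1 for some real α, and B sat(-xc; um, up) = 0}`. -/
def loadBalancingSet {V E : Type*} [Fintype V] [DecidableEq V] [Fintype E]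
    (G : DiMultigraph V E) (H : EuclideanSpace ℝ V → ℝ) (um up : E → ℝ) :
    Set (EuclideanSpace ℝ V × EuclideanSpace ℝ E) :=
  {p | (∃ α : ℝ, ∀ v, gradient H p.1 v = α) ∧
    G.incidence *ᵥ satVec (-p.2.ofLp) um up = 0}

end

/-! The splitting serves only to produce a circulation `g` (`B g = 0`) strictly inside the bounds:
send round each augmented cycle a value interior to all its intervals, then add the copies of each
edge (`exists_circulation_mem_Ioo`). Since `sat - g` is increasing and changes sign, it is the
gradient of a convex, nonnegative, proper `Φ`. With `z = -Bᵀ∇H(x) - x_c` and `v = x'`, the function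
`W = H(x) + Φ(z)` satisfies `W' = -⟪v, ∇²H v⟫`. As `1ᵀx` is conserved and `H` is proper on that
hyperplane, the trajectory is bounded. In place of an invariance principle, two Barbalat-type lemmas
give limits directly: `v → 0`, as `W` is bounded below and `v` is Lipschitz; then `Bᵀ∇H(x) → 0`, as
it is the derivative of the bounded `x_c` and its own derivative tends to zero. Hence `B sat(-x_c) →
0` too (`saturated_pi_control_convergence`). By strong connectivity, common zeros of these two
quantities lie in the target set, and compactness gives convergence. -/

open scoped RealInnerProductSpace NNReal

/-! ### Barbalat-type lemmas and convergence to a zero set -/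

/-- If `W' ≤ -lam ‖v‖²` for a function `W` that is bounded below and a Lipschitz function `v`,
then `v` vanishes at infinity. -/
theorem tendsto_zero_of_deriv_le_neg_mul_sq {F : Type*} [NormedAddCommGroup F]
    {v : ℝ → F} {W W' : ℝ → ℝ} {K lam m : ℝ} (hlam : 0 < lam)
    (hv : ∀ s ∈ Ici (0 : ℝ), ∀ t ∈ Ici (0 : ℝ), ‖v t - v s‖ ≤ K * ‖t - s‖)
    (hW : ∀ t ∈ Ici (0 : ℝ), HasDerivWithinAt W (W' t) (Ici 0) t)
    (hW' : ∀ t ∈ Ici (0 : ℝ), W' t ≤ -lam * ‖v t‖ ^ 2)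
    (hm : ∀ t ∈ Ici (0 : ℝ), m ≤ W t) :
    Tendsto v atTop (𝓝 0) := by
  have hcont : ContinuousOn W (Ici 0) := fun t ht => (hW t ht).continuousWithinAt
  have hdec : ∀ c a b : ℝ, 0 ≤ a → a ≤ b → (∀ t ∈ Icc a b, W' t ≤ -c) →
      W b ≤ W a - c * (b - a) := by
    intro c a b ha hab h
    have hsub : Icc a b ⊆ Ici 0 := fun t ht => ha.trans ht.1
    have := antitoneOn_of_hasDerivWithinAt_nonpos (f := fun t => W t + c * t)
      (f' := fun t => W' t + c) (convex_Icc a b)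
      ((hcont.mono hsub).add (by fun_prop))
      (fun t ht => by
        have := ((hW t (hsub (interior_subset ht))).mono
          (interior_subset.trans hsub)).add ((hasDerivWithinAt_id t _).const_mul c)
        exact this.congr_deriv (by ring))
      (fun t ht => by linarith [h t (interior_subset ht)])
      (left_mem_Icc.2 hab) (right_mem_Icc.2 hab) hab
    simp only at this
    linarith
  have hanti : ∀ a b, 0 ≤ a → a ≤ b → W b ≤ W a := by
    intro a b ha hab
    have := hdec 0 a b ha hab (fun t ht => by
      have := hW' t (ha.trans ht.1)
      nlinarith [sq_nonneg ‖v t‖])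
    linarith
  have hbdd : BddBelow (W '' Ici 0) := ⟨m, by rintro _ ⟨t, ht, rfl⟩; exact hm t ht⟩
  have hne : (W '' Ici 0).Nonempty := ⟨_, 0, self_mem_Ici, rfl⟩
  set l := sInf (W '' Ici 0) with hl
  have hle : ∀ t, 0 ≤ t → l ≤ W t := fun t ht => csInf_le hbdd ⟨t, ht, rfl⟩
  rw [Metric.tendsto_atTop]
  intro ε hε
  have hK : 0 < |K| + 1 := by positivity
  -- If `‖v t‖ ≥ ε`, the Lipschitz bound keeps `‖v‖ ≥ ε / 2` on `[t, t + δ]`, so `W` drops there by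
  -- at least `c * δ`. After `t₀`, where `W` is within `c * δ` of its infimum, this is impossible.
  set δ := ε / (2 * (|K| + 1)) with hδ
  have hδ0 : 0 < δ := by positivity
  set c := lam * (ε / 2) ^ 2 with hc
  have hc0 : 0 < c := by positivity
  obtain ⟨_, ⟨t₀, ht₀, rfl⟩, hlt⟩ := exists_lt_of_csInf_lt hne
    (show sInf (W '' Ici 0) < l + c * δ by rw [← hl]; nlinarith [mul_pos hc0 hδ0])
  refine ⟨t₀, fun t ht => ?_⟩
  have ht0 : (0 : ℝ) ≤ t := le_trans ht₀ ht
  rw [dist_zero_right]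
  by_contra! hcon
  have key := hdec c t (t + δ) ht0 (by linarith) (fun s hs => by
    have hs0 : (0 : ℝ) ≤ s := ht0.trans hs.1
    have h1 := hv t ht0 s hs0
    have h2 : ‖s - t‖ ≤ δ := by
      rw [Real.norm_eq_abs, abs_of_nonneg (by linarith [hs.1])]; linarith [hs.2]
    have h3 : K * ‖s - t‖ ≤ (|K| + 1) * δ :=
      mul_le_mul (by linarith [le_abs_self K]) h2 (norm_nonneg _) hK.le
    have h4 : (|K| + 1) * δ = ε / 2 := by rw [hδ]; field_simp
    have h5 : ‖v t‖ ≤ ‖v s‖ + ‖v s - v t‖ := by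
      have := norm_sub_norm_le (v t) (v s)
      rw [norm_sub_rev] at this; linarith
    have h6 : ε / 2 ≤ ‖v s‖ := by linarith
    have h7 := hW' s hs0
    have h8 : (ε / 2) ^ 2 ≤ ‖v s‖ ^ 2 := pow_le_pow_left₀ (by positivity) h6 2
    rw [hc]; nlinarith)
  have := hle (t + δ) (by linarith)
  have := hanti t₀ t ht₀ ht
  have e : c * (t + δ - t) = c * δ := by ring
  linarith

/-- The derivative of a bounded function vanishes at infinity if the second derivative does. -/
theorem tendsto_zero_of_bounded_of_deriv_tendsto_zero {F : Type*} [NormedAddCommGroup F]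
    [NormedSpace ℝ F] {y w w' : ℝ → F} {M : ℝ}
    (hM : ∀ t ∈ Ici (0 : ℝ), ‖y t‖ ≤ M)
    (hy : ∀ t ∈ Ici (0 : ℝ), HasDerivWithinAt y (w t) (Ici 0) t)
    (hw : ∀ t ∈ Ici (0 : ℝ), HasDerivWithinAt w (w' t) (Ici 0) t)
    (hw' : Tendsto w' atTop (𝓝 0)) :
    Tendsto w atTop (𝓝 0) := by
  rw [Metric.tendsto_atTop] at hw' ⊢
  intro ε hε
  have hM0 : 0 ≤ M := (norm_nonneg _).trans (hM 0 self_mem_Ici)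
  -- On a window of length `τ` the derivative `w` varies by at most `ε / 4`, so `τ‖w t‖ ≤ 2M +
  -- τε/4`. With `τε = 4(M + 1)`, having `‖w t‖ ≥ ε` would give `4M + 4 ≤ 3M + 1`.
  set τ := 4 * (M + 1) / ε with hτ
  have hτ0 : 0 < τ := by positivity
  obtain ⟨N, hN⟩ := hw' (ε / (4 * τ)) (by positivity)
  refine ⟨max N 0, fun t ht => ?_⟩
  have htN : N ≤ t := (le_max_left _ _).trans ht
  have ht0 : 0 ≤ t := (le_max_right _ _).trans ht
  have hsub : Icc t (t + τ) ⊆ Ici 0 := fun s hs => ht0.trans hs.1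
  have hl : t ∈ Icc t (t + τ) := ⟨le_rfl, by linarith⟩
  have hr : t + τ ∈ Icc t (t + τ) := ⟨by linarith, le_rfl⟩
  have h1 : ∀ s ∈ Icc t (t + τ), ‖w s - w t‖ ≤ ε / 4 := by
    intro s hs
    have := (convex_Icc t (t + τ)).norm_image_sub_le_of_norm_hasDerivWithin_le
      (C := ε / (4 * τ))
      (fun r hr => (hw r (hsub hr)).mono hsub)
      (fun r hr => by simpa using (hN r (htN.trans hr.1)).le) hl hs
    refine this.trans ?_
    have h2 : ‖s - t‖ ≤ τ := by
      rw [Real.norm_eq_abs, abs_of_nonneg (by linarith [hs.1])]; linarith [hs.2]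
    calc ε / (4 * τ) * ‖s - t‖ ≤ ε / (4 * τ) * τ := by gcongr
      _ = ε / 4 := by field_simp
  have h2 := (convex_Icc t (t + τ)).norm_image_sub_le_of_norm_hasDerivWithin_le
      (f := fun s => y s - (s - t) • w t) (f' := fun s => w s - w t) (C := ε / 4)
      (fun r hr => by
        have := ((hy r (hsub hr)).mono hsub).sub
          ((((hasDerivWithinAt_id r _).sub_const t)).smul_const (w t))
        exact this.congr_deriv (by simp))
      h1 hl hr
  simp only [add_sub_cancel_left, sub_self, zero_smul, sub_zero] at h2
  rw [Real.norm_eq_abs, abs_of_pos hτ0] at h2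
  have h3 : ‖τ • w t‖ ≤ 2 * M + ε / 4 * τ := by
    have e : τ • w t = y (t + τ) - y t - (y (t + τ) - τ • w t - y t) := by abel
    rw [e]
    refine (norm_sub_le _ _).trans (add_le_add ((norm_sub_le _ _).trans ?_) h2)
    linarith [hM t ht0, hM (t + τ) (hsub hr)]
  rw [norm_smul, Real.norm_eq_abs, abs_of_pos hτ0] at h3
  rw [dist_zero_right]
  have h4 : τ * ε = 4 * (M + 1) := by rw [hτ]; field_simp
  by_contra! hcon
  nlinarith

/-- If a continuous function vanishes asymptotically along a bounded curve, then the curve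
converges to its zero set. -/
theorem tendsto_infEDist_of_tendsto_zero {P Q : Type*} [PseudoMetricSpace P] [ProperSpace P]
    [NormedAddCommGroup Q] {p : ℝ → P} {f : P → Q} {S : Set P} (hf : Continuous f)
    (hb : Bornology.IsBounded (p '' Ici 0)) (hS : ∀ q, f q = 0 → q ∈ S)
    (h : Tendsto (fun t => f (p t)) atTop (𝓝 0)) :
    Tendsto (fun t => Metric.infEDist (p t) S) atTop (𝓝 0) := by
  rw [ENNReal.tendsto_nhds_zero]
  intro ε hε
  -- On this compact set `f` has no zero, hence is bounded away from it. If `S` were empty the set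
  -- would be the whole closure, so non-emptiness of `S` is part of the conclusion.
  have hK : IsCompact (closure (p '' Ici 0) ∩ {q | ε ≤ Metric.infEDist q S}) :=
    hb.isCompact_closure.inter_right (isClosed_le continuous_const Metric.continuous_infEDist)
  have hη : ∃ η > 0, ∀ q ∈ closure (p '' Ici 0) ∩ {q | ε ≤ Metric.infEDist q S}, η ≤ ‖f q‖ := by
    rcases Set.eq_empty_or_nonempty
      (closure (p '' Ici 0) ∩ {q | ε ≤ Metric.infEDist q S}) with he | hne
    · exact ⟨1, one_pos, by simp [he]⟩
    · obtain ⟨q, hq, hmin⟩ := hK.exists_isMinOn hne hf.norm.continuousOn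
      refine ⟨‖f q‖, norm_pos_iff.2 fun h0 => ?_, fun r hr => hmin hr⟩
      have := hq.2
      rw [mem_ofPred_eq, Metric.infEDist_zero_of_mem (hS q h0)] at this
      exact hε.not_ge this
  obtain ⟨η, hη0, hη⟩ := hη
  have h' : ∀ᶠ t in atTop, ‖f (p t)‖ < η := by
    have := h.norm
    rw [norm_zero] at this
    exact this.eventually_lt_const hη0
  filter_upwards [h', eventually_ge_atTop 0] with t ht ht0
  by_contra! hcon
  exact absurd (hη (p t) ⟨subset_closure ⟨t, ht0, rfl⟩, hcon.le⟩) (not_le.2 ht)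

/-! ### Lyapunov analysis of the abstract saturated PI loop -/

/-- A continuous family of positive definite operators on a finite-dimensional space is uniformly
positive definite on bounded sets. -/
theorem exists_uniform_lower_bound_of_pos {X : Type*} [NormedAddCommGroup X]
    [InnerProductSpace ℝ X] [FiniteDimensional ℝ X] {A : X → X →L[ℝ] X} (hA : Continuous A)
    (hpos : ∀ x v, v ≠ 0 → 0 < ⟪v, A x v⟫) (R : ℝ) :
    ∃ lam > 0, ∀ x v, ‖x‖ ≤ R → lam * ‖v‖ ^ 2 ≤ ⟪v, A x v⟫ := by
  have hK : IsCompact (Metric.closedBall (0 : X) R ×ˢ Metric.sphere (0 : X) 1) :=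
    (isCompact_closedBall _ _).prod (isCompact_sphere _ _)
  have hf : Continuous fun q : X × X => ⟪q.2, A q.1 q.2⟫ := by fun_prop
  have hlam : ∃ lam > 0, ∀ q ∈ Metric.closedBall (0 : X) R ×ˢ Metric.sphere (0 : X) 1,
      lam ≤ ⟪q.2, A q.1 q.2⟫ := by
    rcases Set.eq_empty_or_nonempty
      (Metric.closedBall (0 : X) R ×ˢ Metric.sphere (0 : X) 1) with he | hne
    · exact ⟨1, one_pos, by simp [he]⟩
    · obtain ⟨q, hq, hmin⟩ := hK.exists_isMinOn hne hf.continuousOn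
      refine ⟨_, hpos q.1 q.2 fun h0 => ?_, fun r hr => hmin hr⟩
      have := hq.2
      simp [h0] at this
  obtain ⟨lam, h0, h⟩ := hlam
  refine ⟨lam, h0, fun x v hx => ?_⟩
  rcases eq_or_ne v 0 with rfl | hv
  · simp
  have hn : ‖v‖ ≠ 0 := norm_ne_zero_iff.2 hv
  have := h (x, ‖v‖⁻¹ • v) ⟨by simpa using hx, by simp [norm_smul, hn]⟩
  simp only [map_smul, inner_smul_left, inner_smul_right] at this
  have e : ⟪v, A x v⟫ = ‖v‖ ^ 2 * ((starRingEnd ℝ) ‖v‖⁻¹ * (‖v‖⁻¹ * ⟪v, A x v⟫)) := by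
    simp; field_simp
  have e2 := mul_le_mul_of_nonneg_left this (sq_nonneg ‖v‖)
  linarith

/-- The gradient of a `C²` function is `C¹`. -/
theorem ContDiff.gradient_of_two {X : Type*} [NormedAddCommGroup X] [InnerProductSpace ℝ X]
    [CompleteSpace X] {H : X → ℝ} (hH : ContDiff ℝ 2 H) : ContDiff ℝ 1 (gradient H) :=
  (InnerProductSpace.toDual ℝ X).symm.contDiff.comp (hH.fderiv_right (m := 1) (by norm_num))

/-- For a gradient system interconnected with a saturated PI controller, if the controller
nonlinearity `σ - g` is the gradient of a proper nonnegative function `Φ` for some `g` in the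
kernel of `B`, then trajectories are bounded and approach the set of steady states. -/
theorem saturated_pi_control_convergence {X Y : Type*} [NormedAddCommGroup X]
    [InnerProductSpace ℝ X] [FiniteDimensional ℝ X] [NormedAddCommGroup Y]
    [InnerProductSpace ℝ Y] [FiniteDimensional ℝ Y]
    {B : Y →L[ℝ] X} {D : X →L[ℝ] Y} (hBD : ∀ a y, ⟪B y, a⟫ = ⟪y, D a⟫)
    {H : X → ℝ} (hH : ContDiff ℝ 2 H)
    (hpos : ∀ a v, v ≠ 0 → 0 < ⟪v, fderiv ℝ (gradient H) a v⟫)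
    {σ : Y → Y} {K : ℝ≥0} (hσ : LipschitzWith K σ) {g : Y} (hg : B g = 0)
    {Φ : Y → ℝ} (hΦ : ∀ y, HasGradientAt Φ (σ y - g) y) (hΦ0 : ∀ y, 0 ≤ Φ y)
    (hΦb : ∀ M, Bornology.IsBounded {y | Φ y ≤ M})
    {S : Set X} (hS : Tendsto H (Bornology.cobounded X ⊓ 𝓟 S) atTop)
    {x : ℝ → X} {xc : ℝ → Y} (hxS : ∀ t ∈ Ici (0 : ℝ), x t ∈ S)
    (hx : ∀ t ∈ Ici (0 : ℝ), HasDerivWithinAt x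
      (B (σ (-D (gradient H (x t)) - xc t))) (Ici 0) t)
    (hxc : ∀ t ∈ Ici (0 : ℝ), HasDerivWithinAt xc (D (gradient H (x t))) (Ici 0) t) :
    Bornology.IsBounded ((fun t => (x t, xc t)) '' Ici 0) ∧
    Tendsto (fun t => D (gradient H (x t))) atTop (𝓝 0) ∧
    Tendsto (fun t => B (σ (-xc t))) atTop (𝓝 0) := by
  set p := gradient H with hp
  set A := fderiv ℝ p with hA
  have hp1 : ContDiff ℝ 1 p := hH.gradient_of_two
  have hAc : Continuous A := hp1.continuous_fderiv (by norm_num)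
  have hpA : ∀ a, HasFDerivAt p (A a) a := fun a =>
    (hp1.differentiable (by norm_num) a).hasFDerivAt
  set z : ℝ → Y := fun t => -D (p (x t)) - xc t with hz
  set v : ℝ → X := fun t => B (σ (z t)) with hv
  have hx' : ∀ t ∈ Ici (0 : ℝ), HasDerivWithinAt x (v t) (Ici 0) t := hx
  have hpx : ∀ t ∈ Ici (0 : ℝ), HasDerivWithinAt (fun s => D (p (x s)))
      (D (A (x t) (v t))) (Ici 0) t := fun t ht =>
    D.hasFDerivAt.comp_hasDerivWithinAt t ((hpA (x t)).comp_hasDerivWithinAt t (hx' t ht))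
  have hzd : ∀ t ∈ Ici (0 : ℝ), HasDerivWithinAt z
      (-D (A (x t) (v t)) - D (p (x t))) (Ici 0) t := fun t ht => (hpx t ht).neg.sub (hxc t ht)
  have hW : ∀ t ∈ Ici (0 : ℝ), HasDerivWithinAt (fun s => H (x s) + Φ (z s))
      (-⟪v t, A (x t) (v t)⟫) (Ici 0) t := by
    intro t ht
    have h1 := (hH.differentiable (by norm_num) (x t)).hasGradientAt.hasFDerivAt
      |>.comp_hasDerivWithinAt t (hx' t ht)
    have h2 := (hΦ (z t)).hasFDerivAt.comp_hasDerivWithinAt t (hzd t ht)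
    -- Because `B g = 0`, replacing `σ` by `σ - g` leaves `v` unchanged; the `⟪∇H, v⟫` contributions
    -- of `H` and `Φ` then cancel.
    have h3 : B (σ (z t) - g) = v t := by rw [map_sub, hg, sub_zero]
    refine (h1.add h2).congr_deriv ?_
    simp only [InnerProductSpace.toDual_apply_apply, inner_sub_right, inner_neg_right, ← hBD, h3]
    rw [real_inner_comm]
    ring
  have hanti : ∀ t ∈ Ici (0 : ℝ), H (x t) + Φ (z t) ≤ H (x 0) + Φ (z 0) := by
    intro t ht
    refine antitoneOn_of_hasDerivWithinAt_nonpos (convex_Ici (0 : ℝ))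
      (fun s hs => (hW s hs).continuousWithinAt)
      (fun s hs => (hW s (interior_subset hs)).mono interior_subset)
      (fun s hs => ?_) self_mem_Ici ht ht
    rcases eq_or_ne (v s) 0 with h0 | h0
    · simp [h0]
    · exact neg_nonpos.2 (hpos _ _ h0).le
  have hHb : ∀ M, ∃ R, ∀ a ∈ S, H a ≤ M → ‖a‖ ≤ R := by
    intro M
    have h1 := hS.eventually (eventually_gt_atTop M)
    rw [eventually_inf_principal] at h1
    have h2 : Bornology.IsBounded {a | a ∈ S → M < H a}ᶜ := by
      rw [Bornology.isBounded_def, compl_compl]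
      exact h1
    obtain ⟨R, hR⟩ := h2.exists_norm_le
    exact ⟨R, fun a ha hle => hR a fun h => (h ha).not_ge hle⟩
  -- On `S`, points with `H ≤ 0` lie in a compact ball, and elsewhere `0` is a lower bound.
  obtain ⟨h0, hh0⟩ : ∃ h0, ∀ a ∈ S, h0 ≤ H a := by
    obtain ⟨R, hR⟩ := hHb 0
    obtain ⟨c, hc⟩ := (isCompact_closedBall (0 : X) R).bddBelow_image
      hH.continuous.continuousOn
    refine ⟨min c 0, fun a ha => ?_⟩
    rcases le_or_gt (H a) 0 with h | h
    · exact (min_le_left _ _).trans (hc ⟨a, by simpa using hR a ha h, rfl⟩)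
    · exact (min_le_right _ _).trans h.le
  obtain ⟨R, hR⟩ := hHb (H (x 0) + Φ (z 0))
  have hxR : ∀ t ∈ Ici (0 : ℝ), ‖x t‖ ≤ R := fun t ht =>
    hR _ (hxS t ht) (by linarith [hanti t ht, hΦ0 (z t)])
  obtain ⟨Z, hZ⟩ := (hΦb (H (x 0) + Φ (z 0) - h0)).exists_norm_le
  have hzZ : ∀ t ∈ Ici (0 : ℝ), ‖z t‖ ≤ Z := fun t ht =>
    hZ _ (by simp only [mem_ofPred_eq]; linarith [hanti t ht, hh0 _ (hxS t ht)])
  obtain ⟨Mw, hMw⟩ : ∃ M, ∀ t ∈ Ici (0 : ℝ), ‖D (p (x t))‖ ≤ M := by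
    obtain ⟨M, hM⟩ := (isCompact_closedBall (0 : X) R).exists_bound_of_continuousOn
      (D.continuous.comp hp1.continuous).continuousOn
    exact ⟨M, fun t ht => hM _ (by simpa using hxR t ht)⟩
  obtain ⟨MA, hMA⟩ : ∃ M, ∀ t ∈ Ici (0 : ℝ), ‖A (x t)‖ ≤ M := by
    obtain ⟨M, hM⟩ := (isCompact_closedBall (0 : X) R).exists_bound_of_continuousOn
      hAc.continuousOn
    exact ⟨M, fun t ht => hM _ (by simpa using hxR t ht)⟩
  have hMA0 : 0 ≤ MA := (norm_nonneg _).trans (hMA 0 self_mem_Ici)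
  have hxcM : ∀ t ∈ Ici (0 : ℝ), ‖xc t‖ ≤ Mw + Z := by
    intro t ht
    have e : xc t = -(D (p (x t))) - z t := by simp [hz]
    rw [e]
    refine (norm_sub_le _ _).trans (add_le_add ?_ (hzZ t ht))
    rw [norm_neg]; exact hMw t ht
  have hvL : ∀ a b, ‖B (σ a) - B (σ b)‖ ≤ ‖B‖ * (K * ‖a - b‖) := fun a b => by
    rw [← map_sub]
    exact (B.le_opNorm _).trans (by gcongr; exact hσ.norm_sub_le a b)
  obtain ⟨Mv, hMv⟩ : ∃ M, ∀ t ∈ Ici (0 : ℝ), ‖v t‖ ≤ M := by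
    refine ⟨‖B‖ * (K * Z) + ‖B (σ 0)‖, fun t ht => ?_⟩
    have h1 := hvL (z t) 0
    have h2 := norm_le_norm_sub_add (v t) (B (σ 0))
    have h3 : ‖B‖ * (K * ‖z t - 0‖) ≤ ‖B‖ * (K * Z) := by
      rw [sub_zero]; gcongr; exact hzZ t ht
    linarith
  -- Saturation is only Lipschitz, so `v` need not be differentiable; its Lipschitz bound is
  -- inherited from `z`.
  have hzL : ∀ s ∈ Ici (0 : ℝ), ∀ t ∈ Ici (0 : ℝ),
      ‖z t - z s‖ ≤ (‖D‖ * (MA * Mv) + Mw) * ‖t - s‖ := by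
    intro s hs t ht
    refine (convex_Ici (0 : ℝ)).norm_image_sub_le_of_norm_hasDerivWithin_le hzd
      (fun r hr => (norm_sub_le _ _).trans (add_le_add ?_ (hMw r hr))) hs ht
    rw [norm_neg]
    refine (D.le_opNorm _).trans ?_
    gcongr
    exact ((A (x r)).le_opNorm _).trans
      (mul_le_mul (hMA r hr) (hMv r hr) (norm_nonneg _) hMA0)
  obtain ⟨lam, hlam, hlamle⟩ := exists_uniform_lower_bound_of_pos hAc hpos R
  have hv0 : Tendsto v atTop (𝓝 0) := by
    refine tendsto_zero_of_deriv_le_neg_mul_sq (m := h0)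
      (K := ‖B‖ * (K * (‖D‖ * (MA * Mv) + Mw))) hlam (fun s hs t ht => ?_) hW
      (fun t ht => ?_) (fun t ht => ?_)
    · refine (hvL _ _).trans ?_
      calc ‖B‖ * (K * ‖z t - z s‖) ≤ ‖B‖ * (K * ((‖D‖ * (MA * Mv) + Mw) * ‖t - s‖)) := by
            gcongr; exact hzL s hs t ht
        _ = _ := by ring
    · linarith [hlamle (x t) (v t) (hxR t ht)]
    · linarith [hh0 _ (hxS t ht), hΦ0 (z t)]
  have hw0 : Tendsto (fun t => D (p (x t))) atTop (𝓝 0) := by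
    refine tendsto_zero_of_bounded_of_deriv_tendsto_zero hxcM hxc hpx ?_
    refine squeeze_zero_norm' (a := fun t => ‖D‖ * (MA * ‖v t‖)) ?_ ?_
    · filter_upwards [eventually_ge_atTop 0] with t ht
      refine (D.le_opNorm _).trans ?_
      gcongr
      exact ((A (x t)).le_opNorm _).trans (by gcongr; exact hMA t ht)
    · simpa using ((hv0.norm.const_mul MA).const_mul ‖D‖)
  refine ⟨?_, hw0, ?_⟩
  · refine isBounded_iff_forall_norm_le.2 ⟨max R (Mw + Z), ?_⟩
    rintro _ ⟨t, ht, rfl⟩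
    exact max_le_max (hxR t ht) (hxcM t ht)
  -- The arguments `-xc t` and `z t` differ exactly by `D (p (x t))`, which vanishes in the limit.
  · have h1 : Tendsto (fun t => B (σ (-xc t)) - v t) atTop (𝓝 0) := by
      refine squeeze_zero_norm (a := fun t => ‖B‖ * (K * ‖D (p (x t))‖)) (fun t => ?_) ?_
      · refine (hvL _ _).trans (le_of_eq ?_)
        congr 3
        simp only [hz]
        abel
      · simpa using ((hw0.norm.const_mul (K : ℝ)).const_mul ‖B‖)
    simpa using h1.add hv0

/-! ### The saturation function and its convex potential -/

theorem sat_eq_max_min {a b : ℝ} (h : a ≤ b) (z : ℝ) : sat z a b = max a (min z b) := by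
  unfold sat
  split_ifs with h1 h2
  · rw [max_eq_left ((min_le_left _ _).trans h1)]
  · rw [min_eq_left h2.le, max_eq_right (not_le.1 h1).le]
  · rw [min_eq_right (not_lt.1 h2), max_eq_right h]

theorem lipschitzWith_sat {a b : ℝ} (h : a ≤ b) : LipschitzWith 1 fun z => sat z a b := by
  simp_rw [sat_eq_max_min h]
  exact (LipschitzWith.id.min_const b).const_max a

theorem monotone_sat {a b : ℝ} (h : a ≤ b) : Monotone fun z => sat z a b := by
  simp_rw [sat_eq_max_min h]
  exact fun x y hxy => max_le_max le_rfl (min_le_min hxy le_rfl)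

theorem sat_of_le {z a b : ℝ} (h : z ≤ a) : sat z a b = a := if_pos h

theorem sat_of_mem_Ioo {z a b : ℝ} (h : z ∈ Ioo a b) : sat z a b = z := by
  rw [sat, if_neg (not_le.2 h.1), if_pos h.2]

theorem sat_of_ge {z a b : ℝ} (hab : a < b) (h : b ≤ z) : sat z a b = b := by
  rw [sat, if_neg (not_le.2 (hab.trans_le h)), if_neg (not_lt.2 h)]

/-- The primitive of `sat · a b - g` that vanishes at `g`. -/
noncomputable def satPotential (a b g s : ℝ) : ℝ := ∫ r in g..s, (sat r a b - g)

theorem hasDerivAt_satPotential {a b : ℝ} (h : a ≤ b) (g s : ℝ) :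
    HasDerivAt (satPotential a b g) (sat s a b - g) s := by
  have hc : Continuous fun r => sat r a b - g :=
    (lipschitzWith_sat h).continuous.sub continuous_const
  exact intervalIntegral.integral_hasDerivAt_right (hc.intervalIntegrable _ _)
    (hc.stronglyMeasurableAtFilter _ _) hc.continuousAt

/-- The derivative `sat - g` is monotone, so the potential is convex and lies above its tangents. -/
theorem satPotential_tangent_le {a b : ℝ} (h : a ≤ b) (g c s : ℝ) :
    satPotential a b g c + (sat c a b - g) * (s - c) ≤ satPotential a b g s := by
  have hconv : ConvexOn ℝ univ (satPotential a b g) := by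
    refine MonotoneOn.convexOn_of_deriv convex_univ ?_ ?_ ?_
    · exact fun s _ => (hasDerivAt_satPotential h g s).continuousAt.continuousWithinAt
    · exact fun s _ => (hasDerivAt_satPotential h g s).differentiableAt.differentiableWithinAt
    · have : deriv (satPotential a b g) = fun s => sat s a b - g :=
        funext fun s => (hasDerivAt_satPotential h g s).deriv
      rw [this]
      exact fun s _ t _ hst => sub_le_sub_right (monotone_sat h hst) g
  have hd := hasDerivAt_satPotential h g c
  rcases lt_trichotomy s c with hs | rfl | hs
  · have := hconv.slope_le_of_hasDerivAt (mem_univ s) (mem_univ c) hs hd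
    rw [slope_def_field, div_le_iff₀ (by linarith)] at this
    linarith
  · simp
  · have := hconv.le_slope_of_hasDerivAt (mem_univ c) (mem_univ s) hs hd
    rw [slope_def_field, le_div_iff₀ (by linarith)] at this
    linarith

/-- At `g` both the potential and its slope vanish, since `sat` fixes interior points. -/
theorem satPotential_nonneg {a b g : ℝ} (hg : g ∈ Ioo a b) (s : ℝ) : 0 ≤ satPotential a b g s := by
  have := satPotential_tangent_le (hg.1.trans hg.2).le g g s
  rw [sat_of_mem_Ioo hg] at this
  simpa [satPotential] using this

/-- The tangents at `b` and `a` have slopes `b - g > 0` and `a - g < 0`, which forces linear growth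
on both sides. This is where strict feasibility of `g` is essential. -/
theorem exists_abs_le_of_satPotential_le {a b g : ℝ} (hg : g ∈ Ioo a b) (M : ℝ) :
    ∃ R, ∀ s, satPotential a b g s ≤ M → |s| ≤ R := by
  have hab := hg.1.trans hg.2
  have h1 : 0 < b - g := sub_pos.2 hg.2
  have h2 : 0 < g - a := sub_pos.2 hg.1
  refine ⟨max (b + M / (b - g)) (-(a - M / (g - a))), fun s hs => abs_le'.2 ⟨?_, ?_⟩⟩
  · refine le_max_of_le_left ?_
    have := satPotential_tangent_le hab.le g b s
    rw [sat_of_ge hab le_rfl] at this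
    have := satPotential_nonneg hg b
    rw [← sub_le_iff_le_add', le_div_iff₀ h1]
    linarith
  · refine le_max_of_le_right ?_
    have := satPotential_tangent_le hab.le g a s
    rw [sat_of_le le_rfl] at this
    have := satPotential_nonneg hg a
    have : a - s ≤ M / (g - a) := by
      rw [le_div_iff₀ h2]
      linarith
    linarith

section EuclideanSaturation

variable {E : Type*} [Fintype E]

theorem EuclideanSpace.norm_le_sum_abs (y : EuclideanSpace ℝ E) : ‖y‖ ≤ ∑ e, |y e| := by
  rw [EuclideanSpace.norm_eq, Real.sqrt_le_left (Finset.sum_nonneg fun _ _ => abs_nonneg _)]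
  simpa using Finset.sum_sq_le_sq_sum_of_nonneg (s := Finset.univ) (f := fun e => |y e|)
    (fun _ _ => abs_nonneg _)

theorem lipschitzWith_toLp_satVec {um up : E → ℝ} (h : ∀ e, um e ≤ up e) :
    LipschitzWith 1 fun y : EuclideanSpace ℝ E =>
      (WithLp.toLp 2 (satVec y.ofLp um up) : EuclideanSpace ℝ E) := by
  refine LipschitzWith.of_dist_le_mul fun y z => ?_
  rw [NNReal.coe_one, one_mul, EuclideanSpace.dist_eq, EuclideanSpace.dist_eq]
  gcongr with e
  simpa [satVec] using (lipschitzWith_sat (h e)).dist_le_mul (y e) (z e)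

theorem hasGradientAt_sum_satPotential {um up : E → ℝ} (h : ∀ e, um e ≤ up e)
    (g y : EuclideanSpace ℝ E) :
    HasGradientAt (fun y : EuclideanSpace ℝ E => ∑ e, satPotential (um e) (up e) (g e) (y e))
      (WithLp.toLp 2 (satVec y.ofLp um up) - g) y := by
  rw [hasGradientAt_iff_hasFDerivAt]
  have h1 : ∀ e ∈ Finset.univ, HasFDerivAt
      (fun y : EuclideanSpace ℝ E => satPotential (um e) (up e) (g e) (y e))
      ((sat (y e) (um e) (up e) - g e) • (EuclideanSpace.proj e : EuclideanSpace ℝ E →L[ℝ] ℝ)) y :=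
    fun e _ => HasDerivAt.comp_hasFDerivAt (f := fun y : EuclideanSpace ℝ E => y e) y
      (hasDerivAt_satPotential (h e) (g e) (y e))
      (EuclideanSpace.proj e : EuclideanSpace ℝ E →L[ℝ] ℝ).hasFDerivAt
  refine (HasFDerivAt.fun_sum h1).congr_fderiv ?_
  ext v
  simp [PiLp.inner_apply, satVec, sub_mul, mul_comm (v _), Finset.sum_sub_distrib]

theorem isBounded_sum_satPotential_le {um up : E → ℝ} {g : EuclideanSpace ℝ E}
    (hg : ∀ e, g e ∈ Ioo (um e) (up e)) (M : ℝ) :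
    Bornology.IsBounded
      {y : EuclideanSpace ℝ E | ∑ e, satPotential (um e) (up e) (g e) (y e) ≤ M} := by
  choose R hR using fun e => exists_abs_le_of_satPotential_le (hg e) M
  refine isBounded_iff_forall_norm_le.2 ⟨∑ e, R e, fun y hy => ?_⟩
  refine (EuclideanSpace.norm_le_sum_abs y).trans (Finset.sum_le_sum fun e _ => hR e _ ?_)
  exact (Finset.single_le_sum (f := fun e => satPotential (um e) (up e) (g e) (y e))
    (fun e _ => satPotential_nonneg (hg e) _) (Finset.mem_univ e)).trans hy

end EuclideanSaturation

/-- Translates positive definiteness of the Hessian matrix into the operator form used by the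
Lyapunov argument. -/
theorem inner_fderiv_gradient_eq {V : Type*} [Fintype V] [DecidableEq V]
    {H : EuclideanSpace ℝ V → ℝ} (hH : ContDiff ℝ 2 H) (a v : EuclideanSpace ℝ V) :
    ⟪v, fderiv ℝ (gradient H) a v⟫ = v.ofLp ⬝ᵥ (hessianMatrix H a *ᵥ v.ofLp) := by
  have hd : DifferentiableAt ℝ (gradient H) a :=
    hH.gradient_of_two.differentiable (by norm_num) a
  have h1 : ∀ i u, fderiv ℝ (fun y => gradient H y i) a u = fderiv ℝ (gradient H) a u i := by
    intro i u
    have := ((EuclideanSpace.proj i : EuclideanSpace ℝ V →L[ℝ] ℝ).hasFDerivAt.comp a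
      hd.hasFDerivAt).fderiv
    exact congrArg (fun l => l u) this
  have h2 : v = ∑ j, v j • EuclideanSpace.single j (1 : ℝ) := by
    ext i
    simp [Finset.sum_apply, Pi.single_apply]
  rw [PiLp.inner_apply, dotProduct]
  refine Finset.sum_congr rfl fun i _ => ?_
  have h3 : fderiv ℝ (gradient H) a v i = ∑ j, v j * hessianMatrix H a i j := by
    conv_lhs => rw [h2]
    simp [hessianMatrix, h1]
  rw [h3]
  simp [mulVec, dotProduct, mul_comm]

/-! ### Incidence matrices, cycles and circulations -/

namespace DiMultigraph

variable {V E : Type*}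

theorem incidence_apply [DecidableEq V] (G : DiMultigraph V E) (v : V) (e : E) :
    G.incidence v e = (if G.head e = v then 1 else 0) - if G.tail e = v then 1 else 0 := by
  unfold incidence
  have := G.no_loop e
  split_ifs <;> simp_all

theorem transpose_incidence_mulVec [Fintype V] [DecidableEq V] (G : DiMultigraph V E)
    (f : V → ℝ) (e : E) : (G.incidenceᵀ *ᵥ f) e = f (G.head e) - f (G.tail e) := by
  simp [mulVec, dotProduct, incidence_apply, sub_mul, Finset.sum_sub_distrib]

theorem sum_incidence_mulVec [Fintype V] [DecidableEq V] [Fintype E] (G : DiMultigraph V E)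
    (f : E → ℝ) : ∑ v, (G.incidence *ᵥ f) v = 0 := by
  simp only [mulVec, dotProduct]
  rw [Finset.sum_comm]
  simp [incidence_apply, ← Finset.sum_mul, Finset.sum_sub_distrib]

/-- The two endpoints of every edge carry the same value, and directed paths propagate this
equality. -/
theorem StronglyConnected.eq_of_transpose_incidence_mulVec_eq_zero [Fintype V] [DecidableEq V]
    {G : DiMultigraph V E} (hG : G.StronglyConnected) {f : V → ℝ}
    (hf : G.incidenceᵀ *ᵥ f = 0) (v w : V) : f v = f w := by
  induction hG v w with
  | refl => rfl
  | tail _ h ih =>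
    obtain ⟨e, rfl, rfl⟩ := h
    have := congrFun hf e
    rw [transpose_incidence_mulVec] at this
    rw [ih]
    exact (sub_eq_zero.1 this).symm

/-- Heads are the tails shifted by one, so the cyclic reindexing `i ↦ i + 1` of `Fin (k + 1)`
cancels the two sums. -/
theorem IsCycle.sum_incidence_eq_zero [DecidableEq V] [DecidableEq E] {G : DiMultigraph V E}
    {C : Finset E} (hC : G.IsCycle C) (v : V) : ∑ e ∈ C, G.incidence v e = 0 := by
  obtain ⟨k, e, hinj, hnext, rfl⟩ := hC
  rw [Finset.sum_image fun i _ j _ h => hinj (congrArg G.tail h)]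
  simp only [incidence_apply, hnext, Finset.sum_sub_distrib]
  rw [sub_eq_zero]
  exact Equiv.sum_comp (Equiv.addRight (1 : Fin (k + 1)))
    fun i => if G.tail (e i) = v then (1 : ℝ) else 0

/-- A linear combination of indicators of directed cycles is a circulation. -/
theorem incidence_mulVec_sum_cycles [DecidableEq V] [Fintype E] [DecidableEq E]
    {G : DiMultigraph V E} {T : Finset (Finset E)} (hT : ∀ C ∈ T, G.IsCycle C)
    (c : Finset E → ℝ) :
    G.incidence *ᵥ (fun e => ∑ C ∈ T, if e ∈ C then c C else 0) = 0 := by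
  ext v
  simp only [mulVec, dotProduct, Finset.mul_sum, Pi.zero_apply]
  rw [Finset.sum_comm]
  refine Finset.sum_eq_zero fun C hC => ?_
  simp only [mul_ite, mul_zero, Finset.sum_ite_mem, Finset.univ_inter, ← Finset.sum_mul,
    (hT C hC).sum_incidence_eq_zero v, zero_mul]

theorem incidence_mulVec_augmented [DecidableEq V] [Fintype E] [DecidableEq E]
    (G : DiMultigraph V E) (T : Finset (Finset E)) (f : SplitEdge T → ℝ) :
    G.incidence *ᵥ (fun e => ∑ k, f ⟨e, k⟩) = (G.augmented T).incidence *ᵥ f := by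
  ext v
  simp only [mulVec, dotProduct, Fintype.sum_sigma, Finset.mul_sum]
  rfl

end DiMultigraph

/-! ### From a splitting to a strictly feasible circulation -/

theorem Fin.sum_succ_sub_castSucc {m : ℕ} (c : Fin (m + 1) → ℝ) :
    ∑ k : Fin m, (c k.succ - c k.castSucc) = c (Fin.last m) - c 0 := by
  induction m with
  | zero => simp
  | succ m ih =>
    rw [Fin.sum_univ_castSucc]
    have := ih fun j => c j.castSucc
    simp only [Fin.castSucc_zero] at this
    simp only [← Fin.succ_castSucc] at this ⊢
    rw [this]
    simp

/-- The first copy exceeds `b 0` and the others are nonnegative; the upper bounds telescope to the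
last break point. Both strict inequalities come from the first copy. -/
theorem sum_mem_Ioo_of_splitting {n : ℕ} (hn : 0 < n) {b : Fin (n + 1) → ℝ} {f : Fin n → ℝ}
    (h : ∀ k : Fin n, f k ∈ if (k : ℕ) = 0 then Ioo (b k.castSucc) (b k.succ)
      else Ioo 0 (b k.succ - b k.castSucc)) :
    ∑ k, f k ∈ Ioo (b 0) (b (Fin.last n)) := by
  obtain ⟨m, rfl⟩ := Nat.exists_eq_succ_of_ne_zero hn.ne'
  have h0 := h 0
  have hs : ∀ k : Fin m, f k.succ ∈ Ioo 0 (b k.succ.succ - b k.succ.castSucc) := fun k => by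
    simpa using h k.succ
  simp only [Fin.val_zero, if_true, Fin.castSucc_zero] at h0
  have h1 : ∑ k : Fin m, f k.succ ≤ ∑ k : Fin m, (b k.succ.succ - b k.succ.castSucc) :=
    Finset.sum_le_sum fun k _ => (hs k).2.le
  have h2 : ∑ k : Fin m, (b k.succ.succ - b k.succ.castSucc)
      = b (Fin.last (m + 1)) - b (Fin.succ 0) :=
    Fin.sum_succ_sub_castSucc fun j => b j.succ
  have h3 : 0 ≤ ∑ k : Fin m, f k.succ := Finset.sum_nonneg fun k _ => (hs k).1.le
  rw [Fin.sum_univ_succ]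
  constructor
  · linarith [h0.1]
  · linarith [h0.2]

theorem edgeMultiplicity_pos {E : Type*} [DecidableEq E] {T : Finset (Finset E)} {e : E}
    (h : ∃ C ∈ T, e ∈ C) : 0 < edgeMultiplicity T e := by
  obtain ⟨C, hC, he⟩ := h
  exact Finset.card_pos.2 ⟨C, Finset.mem_filter.2 ⟨hC, he⟩⟩

theorem interior_splitInterval {E : Type*} [DecidableEq E] {T : Finset (Finset E)}
    (b : (e : E) → Fin (edgeMultiplicity T e + 1) → ℝ) (p : SplitEdge T) :
    interior (splitInterval b p) = if (p.2 : ℕ) = 0 then Ioo (b p.1 p.2.castSucc) (b p.1 p.2.succ)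
      else Ioo 0 (b p.1 p.2.succ - b p.1 p.2.castSucc) := by
  unfold splitInterval
  split_ifs <;> exact interior_Icc

/-- A splitting whose cycles have compatible constraint intervals yields a circulation that
satisfies the flow constraints strictly. -/
theorem exists_circulation_mem_Ioo {V E : Type*} [DecidableEq V] [Fintype E] [DecidableEq E]
    {G : DiMultigraph V E} {um up : E → ℝ} {T : Finset (Finset E)} (hT : G.IsCycleCover T)
    {T' : Finset (Finset (SplitEdge T))} (hT' : (G.augmented T).IsNonOverlappingCycleCover T')
    {b : (e : E) → Fin (edgeMultiplicity T e + 1) → ℝ} (hb : IsSplitting T um up b)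
    (hne : ∀ C ∈ T', (interior (⋂ p ∈ C, splitInterval b p)).Nonempty) :
    ∃ g : E → ℝ, G.incidence *ᵥ g = 0 ∧ ∀ e, g e ∈ Ioo (um e) (up e) := by
  have hc : ∃ c : Finset (SplitEdge T) → ℝ, ∀ C ∈ T', c C ∈ interior (⋂ p ∈ C, splitInterval b p) :=
    ⟨fun C => if h : C ∈ T' then (hne C h).choose else 0, fun C hC => by
      simpa only [dif_pos hC] using (hne C hC).choose_spec⟩
  obtain ⟨c, hc⟩ := hc
  set f : SplitEdge T → ℝ := fun p => ∑ C ∈ T', if p ∈ C then c C else 0 with hf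
  have hfmem : ∀ p, f p ∈ interior (splitInterval b p) := by
    intro p
    obtain ⟨C, hC, hp⟩ := hT'.1.2 p
    have : f p = c C := by
      -- Distinct cycles of `T'` are disjoint, so only the cycle through `p` contributes.
      rw [hf]
      simp only
      rw [Finset.sum_eq_single_of_mem C hC, if_pos hp]
      intro D hD hDC
      refine if_neg fun hpD => ?_
      exact Finset.disjoint_left.1 (hT'.2 hD hC hDC) hpD hp
    rw [this]
    exact interior_mono (iInter₂_subset p hp) (hc C hC)
  refine ⟨fun e => ∑ k, f ⟨e, k⟩, ?_, fun e => ?_⟩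
  · rw [G.incidence_mulVec_augmented T f]
    exact DiMultigraph.incidence_mulVec_sum_cycles hT'.1.1 c
  · rw [← hb.first e, ← hb.last e]
    refine sum_mem_Ioo_of_splitting (edgeMultiplicity_pos (hT.2 e)) fun k => ?_
    have := hfmem ⟨e, k⟩
    rwa [interior_splitInterval] at this

/-! ### Application to the closed-loop network -/

theorem theorem2 {V E : Type*} [Fintype V] [DecidableEq V] [Fintype E] [DecidableEq E]
    (G : DiMultigraph V E) (hG : G.StronglyConnected)
    (um up : E → ℝ) (hlt : ∀ e, um e < up e) (hcomp : Compatible um up)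
    (H : EuclideanSpace ℝ V → ℝ) (hH : ContDiff ℝ 2 H)
    (hHess : ∀ x, (hessianMatrix H x).PosDef)
    -- `H` is radially unbounded on every set of states with a given total storage
    (hrad : ∀ c : ℝ, Tendsto H
      (Bornology.cobounded (EuclideanSpace ℝ V) ⊓ 𝓟 {x | ∑ v, x v = c}) atTop)
    (T : Finset (Finset E)) (hT : Minimal G.IsCycleCover T)
    (T' : Finset (Finset (SplitEdge T)))
    (hT' : (G.augmented T).IsNonOverlappingCycleCover T')
    (hsplit : ∃ b : (e : E) → Fin (edgeMultiplicity T e + 1) → ℝ, IsSplitting T um up b ∧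
      ∀ C ∈ T', (interior (⋂ p ∈ C, splitInterval b p)).Nonempty)
    (x : ℝ → EuclideanSpace ℝ V) (xc : ℝ → EuclideanSpace ℝ E)
    (hx : IsClosedLoopTrajectory G H um up x xc) :
    Tendsto (fun t => Metric.infEDist (x t, xc t) (loadBalancingSet G H um up))
      atTop (𝓝 0) := by
  obtain ⟨b, hb, hne⟩ := hsplit
  obtain ⟨g, hg0, hg⟩ := exists_circulation_mem_Ioo hT.prop hT' hb hne
  set B : EuclideanSpace ℝ E →L[ℝ] EuclideanSpace ℝ V :=
    LinearMap.toContinuousLinearMap (Matrix.toEuclideanLin G.incidence) with hB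
  set D : EuclideanSpace ℝ V →L[ℝ] EuclideanSpace ℝ E :=
    LinearMap.toContinuousLinearMap (Matrix.toEuclideanLin G.incidenceᵀ) with hD
  have hBa : ∀ y, B y = WithLp.toLp 2 (G.incidence *ᵥ y.ofLp) := fun _ => rfl
  have hDa : ∀ y, D y = WithLp.toLp 2 (G.incidenceᵀ *ᵥ y.ofLp) := fun _ => rfl
  have hBD : ∀ a y, ⟪B y, a⟫ = ⟪y, D a⟫ := by
    intro a y
    rw [hBa, hDa, EuclideanSpace.inner_eq_star_dotProduct, EuclideanSpace.inner_eq_star_dotProduct]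
    simp only [star_trivial]
    rw [dotProduct_mulVec, ← mulVec_transpose]
  -- The columns of the incidence matrix sum to zero, so total storage is conserved and properness
  -- of `H` is needed only on one hyperplane.
  have hmass : ∀ t ∈ Ici (0 : ℝ), x t ∈ {a : EuclideanSpace ℝ V | ∑ v, a v = ∑ v, x 0 v} := by
    have hd : ∀ t ∈ Ici (0 : ℝ), HasDerivWithinAt (fun s => ∑ v, x s v) 0 (Ici 0) t := by
      intro t ht
      have h1 : ∀ v ∈ Finset.univ, HasDerivWithinAt (fun s => x s v) _ (Ici 0) t := fun v _ =>
        (EuclideanSpace.proj v : EuclideanSpace ℝ V →L[ℝ] ℝ).hasFDerivAt.comp_hasDerivWithinAt t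
          (hx.deriv_x t ht)
      exact (HasDerivWithinAt.fun_sum h1).congr_deriv (G.sum_incidence_mulVec _)
    intro t ht
    have := (convex_Ici (0 : ℝ)).norm_image_sub_le_of_norm_hasDerivWithin_le (C := 0) hd
      (by simp) self_mem_Ici ht
    simpa [sub_eq_zero] using this
  have hpos : ∀ a v, v ≠ 0 → 0 < ⟪v, fderiv ℝ (gradient H) a v⟫ := by
    intro a v hv
    rw [inner_fderiv_gradient_eq hH]
    simpa using (hHess a).dotProduct_mulVec_pos (x := v.ofLp)
      (fun h => hv (WithLp.ofLp_injective 2 h))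
  have hσ := lipschitzWith_toLp_satVec fun e => (hlt e).le
  obtain ⟨hbdd, h1, h2⟩ := saturated_pi_control_convergence (B := B) (D := D) hBD hH hpos hσ
    (g := WithLp.toLp 2 g) (by rw [hBa]; simp [hg0])
    (hasGradientAt_sum_satPotential (fun e => (hlt e).le) (WithLp.toLp 2 g))
    (fun y => Finset.sum_nonneg fun e _ => satPotential_nonneg (hg e) _)
    (isBounded_sum_satPotential_le hg)
    (hrad _) hmass hx.deriv_x hx.deriv_xc
  refine tendsto_infEDist_of_tendsto_zero
    (f := fun q : EuclideanSpace ℝ V × EuclideanSpace ℝ E =>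
      (D (gradient H q.1), B (WithLp.toLp 2 (satVec (-q.2).ofLp um up)))) ?_ hbdd ?_ ?_
  · exact (D.continuous.comp (hH.gradient_of_two.continuous.comp continuous_fst)).prodMk
      (B.continuous.comp (hσ.continuous.comp continuous_snd.neg))
  · rintro ⟨a, y⟩ hq
    rw [Prod.mk_eq_zero] at hq
    have e1 : G.incidenceᵀ *ᵥ (gradient H a).ofLp = 0 := congrArg WithLp.ofLp hq.1
    refine ⟨?_, congrArg WithLp.ofLp hq.2⟩
    rcases isEmpty_or_nonempty V with hV | ⟨⟨w⟩⟩
    · exact ⟨0, fun v => isEmptyElim v⟩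
    · exact ⟨_, fun v => hG.eq_of_transpose_incidence_mulVec_eq_zero e1 v w⟩
  · exact h1.prodMk_nhds h2
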